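/- Let $\Omega\subset\mathbb R^2$ be a bounded domain (non-empty, open, connected, bounded) and let $\mathbf Q=\begin{pmatrix}0&-1\\1&0\end{pmatrix}$. For $c\neq 0$ consider the problem $(P_c)$ of minimising $$\frac12\int_\Omega\big(|\nabla u|^2+|\nabla v|^2\big)\,dx\quad\text{over }(u,v)\in H^1(\Omega;\mathbb R^2)\quad\text{subject to}\quad\int_\Omega\det(\nabla u,\nabla v)\,dx=c .$$ (a) For every $c>0$ there is a minimiser $(u,v)$ of $(P_c)$ such that $u$ and $v$ are harmonic in $\Omega$, neither $u$ nor $v$ is constant in $\Omega$, and the Cauchy–Riemann equations $\nabla u+\mathbf Q\nabla v=\mathbf 0$ hold everywhere in $\Omega$. In particular there are non-trivial pairs of harmonic functions in $\Omega$ that satisfy the Cauchy–Riemann equations. (b) For every $c\neq0$ the problem $(P_c)$ has a minimiser. Every minimiser $(u,v)$ of $(P_c)$, with $s=\operatorname{sign}(c)\in\{1,-1\}$, satisfies the optimality conditions $$\int_\Omega(\nabla u+s\,\mathbf Q\nabla v)\cdot\nabla U\,dx=0,\qquad \int_\Omega(\nabla v-s\,\mathbf Q\nabla u)\cdot\nabla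 U\,dx=0\qquad\text{for all }U\in H^1(\Omega),$$ and, after modification on a null set, $u$ and $v$ are harmonic in $\Omega$, neither is constant in $\Omega$, and $\nabla u+s\,\mathbf Q\nabla v=\mathbf 0$ everywhere in $\Omega$. (For $c<0$ this says that $(u,-v)$ satisfies the Cauchy–Riemann equations.) -/

import Mathlib

open MeasureTheory InnerProductSpace
open scoped ContDiff Gradient Matrix

noncomputable section

/-- The Euclidean plane. -/
abbrev Plane : Type := EuclideanSpace ℝ (Fin 2)

/-- The action of the matrix `Q = !![0, -1; 1, 0]` on a vector of the plane. -/
def rotQ (p : Plane) : Plane := WithLp.toLp 2 (!![0, -1; 1, 0] *ᵥ p.ofLp)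

/-- The determinant of the matrix with rows `p` and `q`. -/
def detPair (p q : Plane) : ℝ := Matrix.det !![p 0, p 1; q 0, q 1]

/-- `g` is a gradient of `u` in the sense of distributions on `Ω`:
`∫_Ω u ∂ᵢφ = -∫_Ω gᵢ φ` for all test functions `φ ∈ C_c^∞(Ω)` and `i = 0, 1`. -/
def IsWeakGradient (Ω : Set Plane) (u : Plane → ℝ) (g : Plane → Plane) : Prop :=
  ∀ φ : Plane → ℝ, ContDiff ℝ ∞ φ → HasCompactSupport φ → tsupport φ ⊆ Ω →
    ∀ i : Fin 2, ∫ x in Ω, u x * fderiv ℝ φ x (EuclideanSpace.single i 1) =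
      -∫ x in Ω, g x i * φ x

/-- The Sobolev space `H¹(Ω)`: functions in `L²(Ω)` with a weak gradient in `L²(Ω)`. -/
def MemH1 (Ω : Set Plane) (u : Plane → ℝ) : Prop :=
  MemLp u 2 (volume.restrict Ω) ∧
    ∃ g : Plane → Plane, MemLp g 2 (volume.restrict Ω) ∧ IsWeakGradient Ω u g

open Classical in
/-- The weak gradient of a function `u ∈ H¹(Ω)` (a version of it; it is unique up to null sets
when `Ω` is open); zero by convention if `u ∉ H¹(Ω)`. -/
def weakGrad (Ω : Set Plane) (u : Plane → ℝ) : Plane → Plane :=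
  if h : MemH1 Ω u then h.2.choose else 0

theorem weakGrad_spec {Ω : Set Plane} {u : Plane → ℝ} (h : MemH1 Ω u) :
    MemLp (weakGrad Ω u) 2 (volume.restrict Ω) ∧ IsWeakGradient Ω u (weakGrad Ω u) := by
  unfold weakGrad
  rw [dif_pos h]
  exact h.2.choose_spec

/-- The Dirichlet energy `½ ∫_Ω (|∇u|² + |∇v|²)`. -/
def dirichletEnergy (Ω : Set Plane) (u v : Plane → ℝ) : ℝ :=
  (1 / 2) * ∫ x in Ω, (‖weakGrad Ω u x‖ ^ 2 + ‖weakGrad Ω v x‖ ^ 2)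

/-- `(u, v)` is admissible: `(u, v) ∈ H¹(Ω; ℝ²)` and `∫_Ω det(∇u, ∇v) = c`. -/
def IsAdmissible (Ω : Set Plane) (c : ℝ) (u v : Plane → ℝ) : Prop :=
  MemH1 Ω u ∧ MemH1 Ω v ∧ ∫ x in Ω, detPair (weakGrad Ω u x) (weakGrad Ω v x) = c

/-- `(u, v)` minimises the Dirichlet energy among all admissible pairs. -/
def IsConstrainedMinimizer (Ω : Set Plane) (c : ℝ) (u v : Plane → ℝ) : Prop :=
  IsAdmissible Ω c u v ∧
    ∀ u' v' : Plane → ℝ, IsAdmissible Ω c u' v' →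
      dirichletEnergy Ω u v ≤ dirichletEnergy Ω u' v'

/-- The optimality conditions of the functional
`∫_Ω (½|∇u|² + ½|∇v|² + s ∇u · Q∇v)` for free variations in `H¹(Ω)`: the weak form of
`div (∇u + s Q∇v) = 0`, `div (∇v - s Q∇u) = 0` in `Ω`, with natural boundary conditions. -/
def SatisfiesOptimality (Ω : Set Plane) (s : ℝ) (u v : Plane → ℝ) : Prop :=
  ∀ U : Plane → ℝ, MemH1 Ω U →
    ∫ x in Ω, inner ℝ (weakGrad Ω u x + s • rotQ (weakGrad Ω v x)) (weakGrad Ω U x) = 0 ∧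
    ∫ x in Ω, inner ℝ (weakGrad Ω v x - s • rotQ (weakGrad Ω u x)) (weakGrad Ω U x) = 0

/-- `u` and `v` are harmonic in `Ω`, neither is constant in `Ω`, and
`∇u + s Q∇v = 0` at every point of `Ω` (classical gradients). -/
def IsNontrivialConjugatePair (Ω : Set Plane) (s : ℝ) (u v : Plane → ℝ) : Prop :=
  HarmonicOnNhd u Ω ∧ HarmonicOnNhd v Ω ∧
  (¬ ∃ a : ℝ, ∀ x ∈ Ω, u x = a) ∧ (¬ ∃ a : ℝ, ∀ x ∈ Ω, v x = a) ∧
  ∀ x ∈ Ω, ∇ u x + s • rotQ (∇ v x) = 0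

end

/-!
If `s = ±1` then `|∇u + s Q∇v|² = |∇u|² + |∇v|² - 2 s det(∇u, ∇v)`, so on the constraint set the
Dirichlet energy equals `s c + ½ ∫ |∇u + s Q∇v|²`. For `s = sign c` the lower bound `s c = |c|` is
attained by a pair of linear functions, hence the minimisers are exactly the admissible pairs
whose weak gradients satisfy the Cauchy–Riemann equations almost everywhere; the optimality
conditions are then immediate.

Regularity is Weyl's lemma for the function `u + i s v`. Mollifying a distributional solution of
the Cauchy–Riemann equations gives holomorphic functions, which by the mean value property are
left unchanged by convolution with a radial kernel `η` of mass one. Since convolutions commute,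
removing the mollification shows that `η ⋆ F = F` almost everywhere, and `η ⋆ F` is holomorphic.
-/

section MeanValue

open Complex Filter Metric Topology Real
open scoped Convolution

variable {E : Type*} [NormedAddCommGroup E] [NormedSpace ℂ E]

theorem integral_comp_mul_of_norm_eq_one (k : ℂ → E) {w : ℂ} (hw : ‖w‖ = 1) :
    ∫ t, k (w * t) = ∫ t, k t := by
  let ρ : ℂ ≃ₗᵢ[ℝ] ℂ := rotation ⟨w, mem_sphere_zero_iff_norm.2 hw⟩
  exact ρ.measurePreserving.integral_comp ρ.toHomeomorph.measurableEmbedding k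

theorem circleAverage_comp_sub_mul [CompleteSpace E] {h : ℂ → E} {x t : ℂ} {R : ℝ}
    (hh : DifferentiableOn ℂ h (ball x R)) (ht : ‖t‖ < R) :
    circleAverage (fun w ↦ h (x - w * t)) 0 1 = h x := by
  have hd : DifferentiableOn ℂ (fun w ↦ h (x - w * t)) (closedBall 0 |1|) := by
    refine hh.comp (by fun_prop) fun w hw ↦ ?_
    rw [abs_one, mem_closedBall_zero_iff] at hw
    rw [mem_ball, dist_self_sub_left, norm_mul]
    exact (mul_le_of_le_one_left (norm_nonneg t) hw).trans_lt ht
  simpa only [zero_mul, sub_zero] using (hd.diffContOnCl_ball subset_rfl).circleAverage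

theorem integral_smul_circleAverage {η : ℂ → ℝ} {h : ℂ → E} {x : ℂ}
    {R R' : ℝ} (hR : R < R') (hh : ContinuousOn h (ball x R')) (hη : Continuous η)
    (hsupp : tsupport η ⊆ closedBall 0 R) :
    ∫ t, η t • circleAverage (fun w ↦ h (x - w * t)) 0 1 =
      circleAverage (fun w ↦ ∫ t, η t • h (x - w * t)) 0 1 := by
  have hS : ∀ k : ℂ → E, ∫ t in closedBall 0 R, η t • k t = ∫ t, η t • k t := fun k ↦
    setIntegral_eq_integral_of_forall_compl_eq_zero fun t ht ↦ by
      rw [image_eq_zero_of_notMem_tsupport fun h ↦ ht (hsupp h), zero_smul]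
  have hcont : ContinuousOn (fun p : ℝ × ℂ ↦ η p.2 • h (x - circleMap 0 1 p.1 * p.2))
      (Set.uIcc 0 (2 * π) ×ˢ closedBall 0 R) := by
    refine (hη.comp continuous_snd).continuousOn.smul (hh.comp (by fun_prop) fun p hp ↦ ?_)
    rw [mem_ball, dist_self_sub_left, norm_mul, norm_circleMap_zero, abs_one, one_mul]
    exact (mem_closedBall_zero_iff.1 hp.2).trans_lt hR
  have hint : Integrable (Function.uncurry fun (θ : ℝ) (t : ℂ) ↦
      η t • h (x - circleMap 0 1 θ * t))
      ((volume.restrict (Set.uIoc 0 (2 * π))).prod (volume.restrict (closedBall 0 R))) := by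
    rw [Measure.prod_restrict]
    exact (hcont.integrableOn_compact (isCompact_uIcc.prod (isCompact_closedBall _ _))).mono_set
      (Set.prod_mono Set.uIoc_subset_uIcc subset_rfl)
  have hswap : ∀ t, η t • circleAverage (fun w ↦ h (x - w * t)) 0 1 =
      (2 * π)⁻¹ • ∫ θ in 0..2 * π, η t • h (x - circleMap 0 1 θ * t) := fun t ↦ by
    rw [circleAverage_def, smul_comm, intervalIntegral.integral_smul]
  rw [← hS, circleAverage_def]
  simp only [hswap, ← hS, integral_smul, intervalIntegral_integral_swap hint]

theorem convolution_radial_eq_smul [CompleteSpace E] {η : ℂ → ℝ} {h : ℂ → E} {x : ℂ} {R R' : ℝ}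
    (hR : R < R') (hh : DifferentiableOn ℂ h (ball x R')) (hη : Continuous η)
    (hrad : ∀ z w : ℂ, ‖z‖ = ‖w‖ → η z = η w) (hsupp : tsupport η ⊆ closedBall 0 R) :
    (η ⋆[ContinuousLinearMap.lsmul ℝ ℝ] h) x = (∫ t, η t) • h x := by
  have hrot : ∀ w ∈ sphere (0 : ℂ) |1|, ∫ t, η t • h (x - w * t) = ∫ t, η t • h (x - t) := by
    intro w hw
    rw [abs_one, mem_sphere_zero_iff_norm] at hw
    rw [← integral_comp_mul_of_norm_eq_one (fun t ↦ η t • h (x - t)) hw]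
    refine integral_congr_ae (.of_forall fun t ↦ ?_)
    simp only [hrad (w * t) t (by rw [norm_mul, hw, one_mul])]
  have havg : ∀ t, η t • circleAverage (fun w ↦ h (x - w * t)) 0 1 = η t • h x := by
    intro t
    by_cases ht : t ∈ tsupport η
    · rw [circleAverage_comp_sub_mul hh ((mem_closedBall_zero_iff.1 (hsupp ht)).trans_lt hR)]
    · simp only [image_eq_zero_of_notMem_tsupport ht, zero_smul]
  calc ∫ t, η t • h (x - t)
    _ = circleAverage (fun w ↦ ∫ t, η t • h (x - w * t)) 0 1 :=
      (circleAverage_const_on_circle hrot).symm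
    _ = ∫ t, η t • h x := by
      rw [← integral_smul_circleAverage hR hh.continuousOn hη hsupp]
      exact integral_congr_ae (.of_forall havg)
    _ = (∫ t, η t) • h x := integral_smul_const _ _

end MeanValue

section Convolution

open Filter Metric Topology
open scoped Convolution

variable {V E : Type*} [NormedAddCommGroup V] [NormedSpace ℝ V] [MeasurableSpace V] [BorelSpace V]
  [NormedAddCommGroup E] [NormedSpace ℝ E] {μ : Measure V} {φ η : V → ℝ} {F : V → E}

theorem fderiv_convolution_lsmul_apply [FiniteDimensional ℝ V] [μ.IsAddHaarMeasure]
    (hφ : ContDiff ℝ 1 φ) (hc : HasCompactSupport φ) (hF : LocallyIntegrable F μ) (y v : V) :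
    fderiv ℝ (φ ⋆[ContinuousLinearMap.lsmul ℝ ℝ, μ] F) y v =
      ∫ t, fderiv ℝ φ (y - t) v • F t ∂μ := by
  let L : (V →L[ℝ] ℝ) →L[ℝ] E →L[ℝ] V →L[ℝ] E := (ContinuousLinearMap.lsmul ℝ ℝ).precompL V
  have hint : Integrable (fun t ↦ L (fderiv ℝ φ t) (F (y - t))) μ :=
    (hc.fderiv (𝕜 := ℝ)).convolutionExists_left L (hφ.continuous_fderiv one_ne_zero) hF y
  rw [(hc.hasFDerivAt_convolution_left _ hφ hF y).fderiv]
  calc (∫ t, L (fderiv ℝ φ t) (F (y - t)) ∂μ) v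
    _ = ∫ t, fderiv ℝ φ t v • F (y - t) ∂μ := ContinuousLinearMap.integral_apply hint v
    _ = ∫ t, fderiv ℝ φ (y - t) v • F t ∂μ := by
      rw [← integral_sub_left_eq_self (fun t ↦ fderiv ℝ φ (y - t) v • F t) μ y]
      simp only [sub_sub_cancel]

theorem convolution_lsmul_left_comm [FiniteDimensional ℝ V] [CompleteSpace E]
    [μ.IsAddHaarMeasure] (hφ : Continuous φ) (hcφ : HasCompactSupport φ) (hη : Continuous η)
    (hcη : HasCompactSupport η) (hF : LocallyIntegrable F μ) :
    φ ⋆[ContinuousLinearMap.lsmul ℝ ℝ, μ] (η ⋆[ContinuousLinearMap.lsmul ℝ ℝ, μ] F) =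
      η ⋆[ContinuousLinearMap.lsmul ℝ ℝ, μ] (φ ⋆[ContinuousLinearMap.lsmul ℝ ℝ, μ] F) := by
  have hFn : LocallyIntegrable (fun t ↦ ‖F t‖) μ := fun t ↦ (hF t).norm
  have hassoc : ∀ {f g : V → ℝ}, Continuous f → HasCompactSupport f → Continuous g →
      HasCompactSupport g →
      (f ⋆[ContinuousLinearMap.mul ℝ ℝ, μ] g) ⋆[ContinuousLinearMap.lsmul ℝ ℝ, μ] F =
        f ⋆[ContinuousLinearMap.lsmul ℝ ℝ, μ] (g ⋆[ContinuousLinearMap.lsmul ℝ ℝ, μ] F) := by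
    intro f g hf hcf hg hcg
    funext x
    exact convolution_assoc (ContinuousLinearMap.mul ℝ ℝ) (ContinuousLinearMap.lsmul ℝ ℝ)
      (ContinuousLinearMap.lsmul ℝ ℝ) (ContinuousLinearMap.lsmul ℝ ℝ) mul_smul
      hf.aestronglyMeasurable hg.aestronglyMeasurable hF.aestronglyMeasurable
      (.of_forall (hcf.convolutionExists_left _ hf hg.locallyIntegrable))
      (.of_forall (hcg.norm.convolutionExists_left _ hg.norm hFn))
      (hcf.norm.convolutionExists_left _ hf.norm
        (hcg.norm.continuous_convolution_left _ hg.norm hFn).locallyIntegrable x)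
  rw [← hassoc hφ hcφ hη hcη, ← hassoc hη hcη hφ hcφ,
    ← convolution_flip (ContinuousLinearMap.mul ℝ ℝ) (f := φ) (g := η),
    ContinuousLinearMap.flip_mul]

theorem exists_radial_mollifier {V : Type*} [NormedAddCommGroup V] [InnerProductSpace ℝ V]
    [FiniteDimensional ℝ V] [MeasurableSpace V] [BorelSpace V] (μ : Measure V)
    [IsFiniteMeasureOnCompacts μ] [μ.IsOpenPosMeasure] {r : ℝ} (hr : 0 < r) :
    ∃ η : V → ℝ, ContDiff ℝ ∞ η ∧ tsupport η ⊆ closedBall 0 r ∧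
      (∀ z w, ‖z‖ = ‖w‖ → η z = η w) ∧ ∫ t, η t ∂μ = 1 := by
  let ρ : ContDiffBump (0 : ℝ) := ⟨r ^ 2 / 2, r ^ 2, by positivity, half_lt_self (by positivity)⟩
  let η : V → ℝ := fun z ↦ ρ (‖z‖ ^ 2)
  have hη : ContDiff ℝ ∞ η := ρ.contDiff.comp (contDiff_norm_sq ℝ)
  have hsupp : tsupport η ⊆ closedBall 0 r := by
    refine closure_minimal (fun t ht ↦ ?_) isClosed_closedBall
    have ht' : ‖t‖ ^ 2 ∈ Function.support ρ := ht
    rw [ρ.support_eq, mem_ball_zero_iff, Real.norm_of_nonneg (by positivity)] at ht'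
    exact mem_closedBall_zero_iff.2 (lt_of_pow_lt_pow_left₀ 2 hr.le ht').le
  have hη0 : η 0 ≠ 0 := by
    have : ρ 0 = 1 := ρ.one_of_mem_closedBall (mem_closedBall_self ρ.rIn_pos.le)
    simp [η, this]
  have hpos : 0 < ∫ t, η t ∂μ := hη.continuous.integral_pos_of_hasCompactSupport_nonneg_nonzero
    ((isCompact_closedBall 0 r).of_isClosed_subset (isClosed_tsupport η) hsupp)
    (fun _ ↦ ρ.nonneg) hη0
  refine ⟨fun z ↦ (∫ t, η t ∂μ)⁻¹ * η z, contDiff_const.mul hη,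
    (closure_mono fun t ht ↦ right_ne_zero_of_mul ht).trans hsupp,
    fun z w hzw ↦ by simp only [η, hzw], ?_⟩
  rw [integral_const_mul, inv_mul_cancel₀ hpos.ne']

end Convolution

section Gluing

open Filter Topology

variable {X Y : Type*} [TopologicalSpace X] [MeasurableSpace X]
  [TopologicalSpace Y] [T2Space Y] {μ : Measure X} [μ.IsOpenPosMeasure] {U : Set X} {f : X → Y}
  {V : X → Set X} {g : X → X → Y}

theorem eventuallyEq_diagonal_of_ae_eq (hU : IsOpen U) (hV : ∀ x ∈ U, IsOpen (V x))
    (hmem : ∀ x ∈ U, x ∈ V x) (hg : ∀ x ∈ U, ContinuousOn (g x) (V x))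
    (hgf : ∀ x ∈ U, g x =ᵐ[μ.restrict (V x)] f) {x : X} (hx : x ∈ U) :
    (fun y ↦ g y y) =ᶠ[𝓝 x] g x := by
  filter_upwards [hU.mem_nhds hx, (hV x hx).mem_nhds (hmem x hx)] with y hy hyx
  have hae : g y =ᵐ[μ.restrict (V y ∩ V x)] g x := by
    filter_upwards [ae_restrict_of_ae_restrict_of_subset Set.inter_subset_left (hgf y hy),
      ae_restrict_of_ae_restrict_of_subset Set.inter_subset_right (hgf x hx)] with z hyz hxz
    rw [hyz, hxz]
  exact Measure.eqOn_open_of_ae_eq hae ((hV y hy).inter (hV x hx))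
    ((hg y hy).mono Set.inter_subset_left) ((hg x hx).mono Set.inter_subset_right)
    ⟨hmem y hy, hyx⟩

theorem diagonal_ae_eq [OpensMeasurableSpace X] [SecondCountableTopology X] (hU : IsOpen U)
    (hV : ∀ x ∈ U, IsOpen (V x)) (hmem : ∀ x ∈ U, x ∈ V x)
    (hg : ∀ x ∈ U, ContinuousOn (g x) (V x)) (hgf : ∀ x ∈ U, g x =ᵐ[μ.restrict (V x)] f) :
    (fun y ↦ g y y) =ᵐ[μ.restrict U] f := by
  rw [EventuallyEq, ae_restrict_iff' hU.measurableSet]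
  refine measure_null_of_locally_null _ fun x hx ↦ ?_
  have hxU : x ∈ U := of_not_not fun h ↦ hx fun hxU ↦ absurd hxU h
  obtain ⟨W, hWg, hWo, hxW⟩ := eventually_nhds_iff.1
    ((eventuallyEq_diagonal_of_ae_eq hU hV hmem hg hgf hxU).and
      ((hV x hxU).mem_nhds (hmem x hxU)))
  refine ⟨_, inter_mem_nhdsWithin _ (hWo.mem_nhds hxW), measure_mono_null ?_
    ((ae_restrict_iff' (hV x hxU).measurableSet).1 (hgf x hxU))⟩
  rintro y ⟨hyU, hyW⟩ hy
  exact hyU fun _ ↦ (hWg y hyW).1.trans (hy (hWg y hyW).2)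

end Gluing

section WeylLemma

open Complex Filter Metric Topology
open scoped Convolution

variable {E : Type*} [NormedAddCommGroup E] [NormedSpace ℂ E] {F F' : ℂ → E} {U : Set ℂ}

/-- Distributional solutions `F` of the Cauchy–Riemann equation `∂F/∂y = i ∂F/∂x` on `U`, with
real-valued test functions. -/
def IsWeaklyHolomorphicOn (F : ℂ → E) (U : Set ℂ) : Prop :=
  ∀ ψ : ℂ → ℝ, ContDiff ℝ ∞ ψ → HasCompactSupport ψ → tsupport ψ ⊆ U →
    ∫ t, fderiv ℝ ψ t I • F t = I • ∫ t, fderiv ℝ ψ t 1 • F t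

theorem IsWeaklyHolomorphicOn.mono {U' : Set ℂ} (hF : IsWeaklyHolomorphicOn F U) (h : U' ⊆ U) :
    IsWeaklyHolomorphicOn F U' :=
  fun ψ hψ hc hs ↦ hF ψ hψ hc (hs.trans h)

theorem IsWeaklyHolomorphicOn.congr (hF : IsWeaklyHolomorphicOn F U) (h : Set.EqOn F' F U) :
    IsWeaklyHolomorphicOn F' U := by
  intro ψ hψ hc hs
  have heq : ∀ v t, fderiv ℝ ψ t v • F' t = fderiv ℝ ψ t v • F t := by
    intro v t
    by_cases ht : t ∈ tsupport ψ
    · rw [h (hs ht)]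
    · simp only [fderiv_of_notMem_tsupport ℝ ht, zero_apply, zero_smul]
  simpa only [heq] using hF ψ hψ hc hs

theorem IsWeaklyHolomorphicOn.differentiableAt_convolution (hw : IsWeaklyHolomorphicOn F U)
    (hF : LocallyIntegrable F) {φ : ℂ → ℝ} (hφ : ContDiff ℝ ∞ φ) {δ : ℝ}
    (hsupp : tsupport φ ⊆ closedBall 0 δ) {y : ℂ} (hy : closedBall y δ ⊆ U) :
    DifferentiableAt ℂ (φ ⋆[ContinuousLinearMap.lsmul ℝ ℝ] F) y := by
  have hc : HasCompactSupport φ :=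
    (isCompact_closedBall 0 δ).of_isClosed_subset (isClosed_tsupport φ) hsupp
  have hφ1 : ContDiff ℝ 1 φ := hφ.of_le (by simp)
  let ψ : ℂ → ℝ := fun t ↦ φ (y - t)
  have hψ : ∀ t v, fderiv ℝ ψ t v = -fderiv ℝ φ (y - t) v := fun t v ↦ by
    have h := (hφ1.differentiable one_ne_zero (y - t)).hasFDerivAt.comp t
      ((hasFDerivAt_id t).const_sub y)
    rw [show fderiv ℝ ψ t = _ from h.fderiv]
    simp
  have hψs : tsupport ψ ⊆ closedBall y δ := by
    refine closure_minimal (fun t ht ↦ ?_) isClosed_closedBall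
    rw [mem_closedBall', dist_eq_norm]
    exact mem_closedBall_zero_iff.1 (hsupp (subset_tsupport φ ht))
  have hCR := hw ψ (hφ.comp (contDiff_const.sub contDiff_id))
    ((isCompact_closedBall y δ).of_isClosed_subset (isClosed_tsupport ψ) hψs) (hψs.trans hy)
  simp only [hψ, neg_smul, integral_neg, smul_neg, neg_inj] at hCR
  refine differentiableAt_complex_iff_differentiableAt_real.2
    ⟨(hc.hasFDerivAt_convolution_left _ hφ1 hF y).differentiableAt, ?_⟩
  rw [fderiv_convolution_lsmul_apply hφ1 hc hF, fderiv_convolution_lsmul_apply hφ1 hc hF, hCR]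

variable [CompleteSpace E]

theorem IsWeaklyHolomorphicOn.ae_convolution_eq (hw : IsWeaklyHolomorphicOn F U)
    (hF : LocallyIntegrable F) {η : ℂ → ℝ} {r R : ℝ} (hrR : r < R) (hη : Continuous η)
    (hrad : ∀ z w : ℂ, ‖z‖ = ‖w‖ → η z = η w) (hsupp : tsupport η ⊆ closedBall 0 r)
    (hη1 : ∫ t, η t = 1) :
    ∀ᵐ z, closedBall z R ⊆ U → (η ⋆[ContinuousLinearMap.lsmul ℝ ℝ] F) z = F z := by
  let φ : ℕ → ContDiffBump (0 : ℂ) := fun n ↦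
    ⟨1 / ((n : ℝ) + 1) / 2, 1 / ((n : ℝ) + 1), by positivity, half_lt_self (by positivity)⟩
  have hφ0 : Tendsto (fun n ↦ (φ n).rOut) atTop (𝓝 0) :=
    tendsto_one_div_add_atTop_nhds_zero_nat
  have hηc : HasCompactSupport η :=
    (isCompact_closedBall 0 r).of_isClosed_subset (isClosed_tsupport η) hsupp
  have hae := ContDiffBump.ae_convolution_tendsto_right_of_locallyIntegrable (μ := volume) (K := 2)
    hφ0 (.of_forall fun n ↦ (mul_div_cancel₀ _ two_ne_zero).ge) hF
  have hηF : Continuous (η ⋆[ContinuousLinearMap.lsmul ℝ ℝ] F) :=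
    hηc.continuous_convolution_left _ hη hF
  filter_upwards [hae] with z hz hball
  have hηz := ContDiffBump.convolution_tendsto_right_of_continuous (μ := volume) hφ0 hηF z
  refine tendsto_nhds_unique hηz (hz.congr' ?_)
  -- Mollifications are holomorphic near `z`, so the radial average `η ⋆ ·` fixes them at `z`.
  filter_upwards [hφ0.eventually_lt_const (half_pos (sub_pos.2 hrR))] with n hn
  have hd : DifferentiableOn ℂ ((φ n).normed volume ⋆[ContinuousLinearMap.lsmul ℝ ℝ] F)
      (ball z ((r + R) / 2)) := fun y hy ↦ by
    refine (hw.differentiableAt_convolution hF (φ n).contDiff_normed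
      (φ n).tsupport_normed_eq.subset ?_).differentiableWithinAt
    exact (closedBall_subset_closedBall' (by linarith [mem_ball.1 hy])).trans hball
  rw [convolution_lsmul_left_comm (φ n).continuous_normed (φ n).hasCompactSupport_normed hη hηc hF,
    convolution_radial_eq_smul (by linarith) hd hη hrad hsupp, hη1, one_smul]

theorem IsWeaklyHolomorphicOn.exists_differentiableOn_ball (hw : IsWeaklyHolomorphicOn F U)
    (hU : IsOpen U) (hF : LocallyIntegrableOn F U) {x : ℂ} (hx : x ∈ U) :
    ∃ r > 0, ∃ G : ℂ → E, DifferentiableOn ℂ G (ball x r) ∧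
      G =ᵐ[volume.restrict (ball x r)] F := by
  obtain ⟨ε, hε, hεU⟩ := nhds_basis_closedBall.mem_iff.1 (hU.mem_nhds hx)
  obtain ⟨r, hr, rfl⟩ : ∃ r : ℝ, 0 < r ∧ 3 * r = ε := ⟨ε / 3, by positivity, by ring⟩
  let F' : ℂ → E := (closedBall x (3 * r)).indicator F
  have hF' : LocallyIntegrable F' := ((integrable_indicator_iff measurableSet_closedBall).2
    (hF.integrableOn_compact_subset hεU (isCompact_closedBall _ _))).locallyIntegrable
  have hw' : IsWeaklyHolomorphicOn F' (closedBall x (3 * r)) :=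
    (hw.mono hεU).congr fun z hz ↦ Set.indicator_of_mem hz F
  obtain ⟨η, hη, hsupp, hrad, hη1⟩ := exists_radial_mollifier (V := ℂ) volume hr
  refine ⟨r, hr, η ⋆[ContinuousLinearMap.lsmul ℝ ℝ] F', fun y hy ↦ ?_, ?_⟩
  · refine (hw'.differentiableAt_convolution hF' hη hsupp ?_).differentiableWithinAt
    exact closedBall_subset_closedBall' (by linarith [mem_ball.1 hy])
  · rw [EventuallyEq, ae_restrict_iff' measurableSet_ball]
    filter_upwards [hw'.ae_convolution_eq hF' (show r < 2 * r by linarith) hη.continuous hrad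
      hsupp hη1] with z hz hzr
    rw [hz (closedBall_subset_closedBall' (by linarith [mem_ball.1 hzr]))]
    exact Set.indicator_of_mem (ball_subset_closedBall (ball_subset_ball (by linarith) hzr)) F

theorem IsWeaklyHolomorphicOn.exists_differentiableOn (hw : IsWeaklyHolomorphicOn F U)
    (hU : IsOpen U) (hF : LocallyIntegrableOn F U) :
    ∃ G : ℂ → E, DifferentiableOn ℂ G U ∧ G =ᵐ[volume.restrict U] F := by
  choose! r hr g hg hgF using fun x (hx : x ∈ U) ↦ hw.exists_differentiableOn_ball hU hF hx
  have hmem : ∀ x ∈ U, x ∈ ball x (r x) := fun x hx ↦ mem_ball_self (hr x hx)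
  have hcont : ∀ x ∈ U, ContinuousOn (g x) (ball x (r x)) := fun x hx ↦ (hg x hx).continuousOn
  refine ⟨fun y ↦ g y y, fun x hx ↦ ?_, diagonal_ae_eq hU (fun _ _ ↦ isOpen_ball) hmem hcont hgF⟩
  have hgx : DifferentiableAt ℂ (g x) x := (hg x hx).differentiableAt (ball_mem_nhds x (hr x hx))
  exact (hgx.congr_of_eventuallyEq (eventuallyEq_diagonal_of_ae_eq hU (fun _ _ ↦ isOpen_ball)
    hmem hcont hgF hx)).differentiableWithinAt

end WeylLemma

section PlaneAlgebra

@[simp] theorem rotQ_apply_zero (p : Plane) : rotQ p 0 = -p 1 := by simp [rotQ, dotProduct]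

@[simp] theorem rotQ_apply_one (p : Plane) : rotQ p 1 = p 0 := by simp [rotQ, dotProduct]

theorem detPair_eq (p q : Plane) : detPair p q = p 0 * q 1 - p 1 * q 0 := by
  simp [detPair, Matrix.det_fin_two]

theorem norm_add_smul_rotQ_sq (s : ℝ) (p q : Plane) :
    ‖p + s • rotQ q‖ ^ 2 = ‖p‖ ^ 2 + s ^ 2 * ‖q‖ ^ 2 - 2 * s * detPair p q := by
  simp only [EuclideanSpace.real_norm_sq_eq, Fin.sum_univ_two, PiLp.add_apply, PiLp.smul_apply,
    smul_eq_mul, rotQ_apply_zero, rotQ_apply_one, detPair_eq]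
  ring

theorem detPair_smul_rotQ (s : ℝ) (p : Plane) : detPair p (s • rotQ p) = s * ‖p‖ ^ 2 := by
  simp only [EuclideanSpace.real_norm_sq_eq, Fin.sum_univ_two, PiLp.smul_apply, smul_eq_mul,
    rotQ_apply_zero, rotQ_apply_one, detPair_eq]
  ring

theorem add_smul_rotQ_smul_rotQ {s : ℝ} (hs : s ^ 2 = 1) (p : Plane) :
    p + s • rotQ (s • rotQ p) = 0 := by
  ext i
  fin_cases i <;>
  · simp only [Fin.zero_eta, Fin.mk_one, PiLp.add_apply, PiLp.smul_apply, rotQ_apply_zero,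
      rotQ_apply_one, smul_eq_mul, PiLp.zero_apply]
    linear_combination (-p _) * hs

theorem sub_smul_rotQ_eq_neg {s : ℝ} (hs : s ^ 2 = 1) (p q : Plane) :
    q - s • rotQ p = -(s • rotQ (p + s • rotQ q)) := by
  ext i
  fin_cases i <;>
  · simp only [Fin.zero_eta, Fin.mk_one, PiLp.add_apply, PiLp.smul_apply, rotQ_apply_zero,
      rotQ_apply_one, smul_eq_mul, PiLp.sub_apply, PiLp.neg_apply]
    linear_combination (-q _) * hs

end PlaneAlgebra

section WeakGradient

theorem integrable_smul_of_tsupport_subset {X E : Type*} [TopologicalSpace X] [T2Space X]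
    [MeasurableSpace X] [OpensMeasurableSpace X] [SecondCountableTopologyEither X ℝ]
    [NormedAddCommGroup E] [NormedSpace ℝ E] {μ : Measure X} {Ω : Set X} {f : X → E} {φ : X → ℝ}
    (hf : LocallyIntegrableOn f Ω μ) (hφ : Continuous φ) (hc : HasCompactSupport φ)
    (hs : tsupport φ ⊆ Ω) : Integrable (fun x ↦ φ x • f x) μ :=
  (integrableOn_iff_integrable_of_support_subset fun _ hx ↦
      subset_tsupport φ (left_ne_zero_of_smul hx)).1
    ((hf.integrableOn_compact_subset hs hc).continuousOn_smul hφ.continuousOn hc)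

theorem locallyIntegrableOn_of_memLp {X E : Type*} [TopologicalSpace X] [MeasurableSpace X]
    [OpensMeasurableSpace X] [NormedAddCommGroup E] {μ : Measure X} [IsLocallyFiniteMeasure μ]
    {Ω : Set X} {f : X → E} {p : ENNReal} (hp : 1 ≤ p) (hf : MemLp f p (μ.restrict Ω)) :
    LocallyIntegrableOn f Ω μ :=
  locallyIntegrableOn_of_locallyIntegrable_restrict (hf.locallyIntegrable hp)

theorem gradient_apply (f : Plane → ℝ) (x : Plane) (i : Fin 2) :
    ∇ f x i = fderiv ℝ f x (EuclideanSpace.single i 1) := by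
  rw [← inner_gradient_left, EuclideanSpace.inner_single_right]
  simp

variable {Ω : Set Plane} {u u' : Plane → ℝ} {g g' : Plane → Plane}

theorem setIntegral_smul_apply {φ : Plane → ℝ} (hg : LocallyIntegrableOn g Ω)
    (hφ : Continuous φ) (hc : HasCompactSupport φ) (hs : tsupport φ ⊆ Ω) (i : Fin 2) :
    (∫ x in Ω, φ x • g x) i = ∫ x in Ω, g x i * φ x := by
  have hint : IntegrableOn (fun x ↦ φ x • g x) Ω :=
    (integrable_smul_of_tsupport_subset hg hφ hc hs).integrableOn
  have h := (EuclideanSpace.proj (𝕜 := ℝ) i : Plane →L[ℝ] ℝ).integral_comp_comm hint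
  refine h.symm.trans (integral_congr_ae (.of_forall fun x ↦ ?_))
  exact mul_comm _ _

theorem IsWeakGradient.congr_ae (h : IsWeakGradient Ω u g) (hu : u' =ᵐ[volume.restrict Ω] u) :
    IsWeakGradient Ω u' g := by
  intro φ hφ hc hs i
  rw [← h φ hφ hc hs i]
  refine integral_congr_ae ?_
  filter_upwards [hu] with x hx
  rw [hx]

theorem isWeakGradient_gradient (Ω : Set Plane) (hu : ContDiff ℝ 1 u) :
    IsWeakGradient Ω u (∇ u) := by
  intro φ hφ hc hs i
  have hφ1 : ContDiff ℝ 1 φ := hφ.of_le (by simp)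
  let e : Plane := EuclideanSpace.single i 1
  have hu' : Continuous fun x ↦ fderiv ℝ u x e :=
    (hu.continuous_fderiv one_ne_zero).clm_apply continuous_const
  have hφ' : Continuous fun x ↦ fderiv ℝ φ x e :=
    (hφ1.continuous_fderiv one_ne_zero).clm_apply continuous_const
  have hΩ : ∀ f : Plane → ℝ, (∀ x ∉ tsupport φ, f x = 0) → ∫ x in Ω, f x = ∫ x, f x :=
    fun f hf ↦ setIntegral_eq_integral_of_forall_compl_eq_zero fun x hx ↦ hf x fun h ↦ hx (hs h)
  simp only [gradient_apply]
  rw [hΩ _ fun x hx ↦ by simp [fderiv_of_notMem_tsupport ℝ hx],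
    hΩ _ fun x hx ↦ by simp [image_eq_zero_of_notMem_tsupport hx]]
  refine integral_mul_fderiv_eq_neg_fderiv_mul_of_integrable ?_ ?_ ?_
    (fun x _ ↦ hu.differentiable one_ne_zero x) (fun x _ ↦ hφ1.differentiable one_ne_zero x)
  · exact (hu'.mul hφ.continuous).integrable_of_hasCompactSupport hc.mul_left
  · exact (hu.continuous.mul hφ').integrable_of_hasCompactSupport
      (hc.fderiv_apply (𝕜 := ℝ) e).mul_left
  · exact (hu.continuous.mul hφ.continuous).integrable_of_hasCompactSupport hc.mul_left

theorem IsWeakGradient.ae_eq (hΩ : IsOpen Ω) (hg : LocallyIntegrableOn g Ω)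
    (hg' : LocallyIntegrableOn g' Ω) (h : IsWeakGradient Ω u g) (h' : IsWeakGradient Ω u g') :
    g =ᵐ[volume.restrict Ω] g' := by
  have hzero : ∀ᵐ x, x ∈ Ω → g x - g' x = 0 := by
    refine hΩ.ae_eq_zero_of_integral_contDiff_smul_eq_zero (hg.sub hg') fun φ hφ hc hs ↦ ?_
    have hint := integrable_smul_of_tsupport_subset hg hφ.continuous hc hs
    have hint' := integrable_smul_of_tsupport_subset hg' hφ.continuous hc hs
    have heq : ∫ x in Ω, φ x • g x = ∫ x in Ω, φ x • g' x := by
      ext i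
      rw [setIntegral_smul_apply hg hφ.continuous hc hs,
        setIntegral_smul_apply hg' hφ.continuous hc hs, ← neg_inj, ← h φ hφ hc hs, h' φ hφ hc hs]
    rw [← setIntegral_eq_integral_of_forall_compl_eq_zero (s := Ω) fun x hx ↦ by
      rw [image_eq_zero_of_notMem_tsupport fun h ↦ hx (hs h), zero_smul]]
    simp only [smul_sub]
    rw [integral_sub hint.integrableOn hint'.integrableOn, heq, sub_self]
  rw [Filter.EventuallyEq, ae_restrict_iff' hΩ.measurableSet]
  filter_upwards [hzero] with x hx hxΩ using sub_eq_zero.1 (hx hxΩ)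

theorem weakGrad_ae_eq (hΩ : IsOpen Ω) (hu : MemLp u 2 (volume.restrict Ω))
    (hg : MemLp g 2 (volume.restrict Ω)) (h : IsWeakGradient Ω u g) :
    weakGrad Ω u =ᵐ[volume.restrict Ω] g :=
  have hspec := weakGrad_spec (⟨hu, g, hg, h⟩ : MemH1 Ω u)
  hspec.2.ae_eq hΩ (locallyIntegrableOn_of_memLp one_le_two hspec.1)
    (locallyIntegrableOn_of_memLp one_le_two hg) h

theorem MemH1.congr_ae (hu : MemH1 Ω u) (h : u' =ᵐ[volume.restrict Ω] u) : MemH1 Ω u' :=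
  ⟨hu.1.ae_eq h.symm, hu.2.imp fun _ hg ↦ ⟨hg.1, hg.2.congr_ae h⟩⟩

theorem weakGrad_congr_ae (hΩ : IsOpen Ω) (hu : MemH1 Ω u) (h : u' =ᵐ[volume.restrict Ω] u) :
    weakGrad Ω u' =ᵐ[volume.restrict Ω] weakGrad Ω u :=
  weakGrad_ae_eq hΩ (hu.congr_ae h).1 (weakGrad_spec hu).1 ((weakGrad_spec hu).2.congr_ae h)

theorem weakGrad_ae_eq_zero (hΩ : IsOpen Ω) (hu : MemH1 Ω u) {a : ℝ}
    (h : ∀ᵐ x ∂volume.restrict Ω, u x = a) : weakGrad Ω u =ᵐ[volume.restrict Ω] 0 := by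
  have hconst : IsWeakGradient Ω (fun _ ↦ a) 0 := by
    convert isWeakGradient_gradient Ω contDiff_const
    exact (gradient_const' a).symm
  exact weakGrad_ae_eq hΩ hu.1 MemLp.zero (hconst.congr_ae h)

theorem isFiniteMeasure_of_memLp_id {E : Type*} [NormedAddCommGroup E] [ProperSpace E]
    [MeasurableSpace E] {μ : Measure E} [IsFiniteMeasureOnCompacts μ] {p : ENNReal}
    (hp0 : p ≠ 0) (hp : p ≠ ⊤) (hid : MemLp id p μ) : IsFiniteMeasure μ := by
  have hcover : Set.univ ⊆ Metric.closedBall (0 : E) 1 ∪ {x | 1 ≤ ‖id x‖₊} := fun x _ ↦ by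
    simpa [← NNReal.coe_le_coe] using le_total ‖x‖ 1
  exact ⟨(measure_mono hcover).trans_lt (measure_union_lt_top
    (isCompact_closedBall 0 1).measure_lt_top (hid.meas_ge_lt_top hp0 hp one_ne_zero))⟩

theorem memLp_id_of_isBounded {Ω : Set Plane} (hΩ : Bornology.IsBounded Ω) (p : ENNReal) :
    MemLp id p (volume.restrict Ω) := by
  obtain ⟨R, hR⟩ := hΩ.subset_closedBall 0
  have : IsFiniteMeasure (volume.restrict (Metric.closedBall (0 : Plane) R)) :=
    isFiniteMeasure_restrict.2 measure_closedBall_lt_top.ne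
  have hball : MemLp id p (volume.restrict (Metric.closedBall (0 : Plane) R)) :=
    MemLp.of_bound aestronglyMeasurable_id R (ae_restrict_of_forall_mem
      measurableSet_closedBall fun x hx ↦ mem_closedBall_zero_iff.1 hx)
  exact hball.mono_measure (Measure.restrict_mono hR le_rfl)

theorem memH1_inner_and_weakGrad_inner (hΩ : IsOpen Ω) (hid : MemLp id 2 (volume.restrict Ω))
    (p : Plane) : MemH1 Ω (fun x ↦ inner ℝ p x) ∧
      weakGrad Ω (fun x ↦ inner ℝ p x) =ᵐ[volume.restrict Ω] fun _ ↦ p := by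
  have := isFiniteMeasure_of_memLp_id two_ne_zero (by simp) hid
  have hmem : MemLp (fun x ↦ inner ℝ p x) 2 (volume.restrict Ω) :=
    hid.continuousLinearMap_comp (innerSL ℝ p)
  have hinner : ∇ (innerSL ℝ p) = fun _ ↦ p := funext fun x ↦ ext_inner_right ℝ fun q ↦ by
    rw [inner_gradient_left, ContinuousLinearMap.fderiv, innerSL_apply_apply]
  have hgrad : IsWeakGradient Ω (fun x ↦ inner ℝ p x) fun _ ↦ p :=
    hinner ▸ isWeakGradient_gradient Ω (innerSL ℝ p).contDiff
  exact ⟨⟨hmem, _, memLp_const p, hgrad⟩, weakGrad_ae_eq hΩ hmem (memLp_const p) hgrad⟩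

end WeakGradient

section ComplexPlane

open Complex ComplexConjugate

variable {E E' F : Type*} [NormedAddCommGroup E] [InnerProductSpace ℝ E] [FiniteDimensional ℝ E]
  [NormedAddCommGroup E'] [InnerProductSpace ℝ E'] [FiniteDimensional ℝ E']
  [NormedAddCommGroup F] [NormedSpace ℝ F]

theorem laplacian_comp_linearIsometryEquiv (e : E' ≃ₗᵢ[ℝ] E) (h : E → F) (y : E') :
    Laplacian.laplacian (h ∘ e) y = Laplacian.laplacian h (e y) := by
  rw [laplacian_eq_iteratedFDeriv_orthonormalBasis _ (stdOrthonormalBasis ℝ E'),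
    laplacian_eq_iteratedFDeriv_orthonormalBasis _ ((stdOrthonormalBasis ℝ E').map e)]
  refine Finset.sum_congr rfl fun i _ ↦ ?_
  have hcomp := e.toContinuousLinearEquiv.iteratedFDerivWithin_comp_right h uniqueDiffOn_univ
    (x := y) (Set.mem_univ _) 2
  simp only [Set.preimage_univ, iteratedFDerivWithin_univ] at hcomp
  refine congr($hcomp _).trans ?_
  rw [ContinuousMultilinearMap.compContinuousLinearMap_apply]
  exact congrArg (iteratedFDeriv ℝ 2 h (e y)) (funext fun j ↦ by fin_cases j <;> rfl)

theorem harmonicAt_comp_linearIsometryEquiv (e : E' ≃ₗᵢ[ℝ] E) {h : E → F} {x : E'}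
    (hh : HarmonicAt h (e x)) : HarmonicAt (h ∘ e) x := by
  refine ⟨hh.1.comp x e.contDiff.contDiffAt, ?_⟩
  filter_upwards [e.continuous.continuousAt.eventually hh.2] with y hy
  rw [laplacian_comp_linearIsometryEquiv, hy]
  rfl

/-- The isometric identification of `ℂ` with the Euclidean plane, sending `1, I` to the standard
basis; functions on the plane are viewed as functions of a complex variable through it. -/
noncomputable def complexToPlane : ℂ ≃ₗᵢ[ℝ] Plane := Complex.orthonormalBasisOneI.repr

@[simp] theorem complexToPlane_apply_zero (z : ℂ) : complexToPlane z 0 = z.re := by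
  simp [complexToPlane]

@[simp] theorem complexToPlane_apply_one (z : ℂ) : complexToPlane z 1 = z.im := by
  simp [complexToPlane]

theorem rotQ_complexToPlane (z : ℂ) : rotQ (complexToPlane z) = complexToPlane (I * z) := by
  ext i
  fin_cases i <;> simp

variable {G : ℂ → ℂ} {Ω : Set Plane} {x : Plane}

theorem fderiv_clm_comp_complexToPlane_symm (L : ℂ →L[ℝ] ℝ)
    (hG : DifferentiableAt ℂ G (complexToPlane.symm x)) (p : Plane) :
    fderiv ℝ (fun y ↦ L (G (complexToPlane.symm y))) x p =
      L (deriv G (complexToPlane.symm x) * complexToPlane.symm p) := by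
  have hd := hG.hasDerivAt.complexToReal_fderiv.comp x
    complexToPlane.symm.toContinuousLinearEquiv.hasFDerivAt
  exact congr($((L.hasFDerivAt.comp x hd).fderiv) p)

theorem gradient_re_comp_complexToPlane_symm
    (hG : DifferentiableAt ℂ G (complexToPlane.symm x)) :
    ∇ (fun y ↦ (G (complexToPlane.symm y)).re) x =
      complexToPlane (conj (deriv G (complexToPlane.symm x))) := by
  refine ext_inner_right ℝ fun p ↦ ?_
  rw [inner_gradient_left, LinearIsometryEquiv.inner_map_eq_flip, Complex.inner, conj_conj,
    mul_comm]
  exact fderiv_clm_comp_complexToPlane_symm reCLM hG p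

theorem gradient_im_comp_complexToPlane_symm
    (hG : DifferentiableAt ℂ G (complexToPlane.symm x)) :
    ∇ (fun y ↦ (G (complexToPlane.symm y)).im) x =
      rotQ (∇ (fun y ↦ (G (complexToPlane.symm y)).re) x) := by
  rw [gradient_re_comp_complexToPlane_symm hG, rotQ_complexToPlane]
  refine ext_inner_right ℝ fun p ↦ ?_
  rw [inner_gradient_left, LinearIsometryEquiv.inner_map_eq_flip, Complex.inner, map_mul,
    conj_conj, conj_I]
  refine (fderiv_clm_comp_complexToPlane_symm imCLM hG p).trans ?_
  rw [mul_left_comm, neg_mul, neg_re, I_mul_re, neg_neg, mul_comm]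
  rfl

theorem harmonicOnNhd_re_and_im_comp_complexToPlane_symm (hΩ : IsOpen Ω)
    (hG : DifferentiableOn ℂ G (complexToPlane ⁻¹' Ω)) :
    HarmonicOnNhd (fun x ↦ (G (complexToPlane.symm x)).re) Ω ∧
      HarmonicOnNhd (fun x ↦ (G (complexToPlane.symm x)).im) Ω := by
  have han : ∀ x ∈ Ω, AnalyticAt ℂ G (complexToPlane.symm x) := fun x hx ↦
    hG.analyticAt ((hΩ.preimage complexToPlane.continuous).mem_nhds (by simpa using hx))
  exact ⟨fun x hx ↦ harmonicAt_comp_linearIsometryEquiv complexToPlane.symm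
      (han x hx).harmonicAt_re,
    fun x hx ↦ harmonicAt_comp_linearIsometryEquiv complexToPlane.symm (han x hx).harmonicAt_im⟩

theorem gradient_re_add_smul_rotQ_gradient_im {s : ℝ} (hs : s ^ 2 = 1)
    (hG : DifferentiableAt ℂ G (complexToPlane.symm x)) :
    ∇ (fun y ↦ (G (complexToPlane.symm y)).re) x +
      s • rotQ (∇ (fun y ↦ s * (G (complexToPlane.symm y)).im) x) = 0 := by
  have him : ∇ (fun y ↦ s * (G (complexToPlane.symm y)).im) x =
      s • ∇ (fun y ↦ (G (complexToPlane.symm y)).im) x := by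
    have hd : DifferentiableAt ℝ (fun y ↦ (G (complexToPlane.symm y)).im) x :=
      imCLM.differentiableAt.comp x ((hG.restrictScalars ℝ).comp x
        complexToPlane.symm.toContinuousLinearEquiv.differentiableAt)
    ext i
    rw [PiLp.smul_apply, gradient_apply, gradient_apply, fderiv_const_mul hd]
    rfl
  rw [him, gradient_im_comp_complexToPlane_symm hG, add_smul_rotQ_smul_rotQ hs]

variable {V : Type*} [NormedAddCommGroup V] [NormedSpace ℂ V] {W : Plane → V}

theorem isWeaklyHolomorphicOn_comp_complexToPlane
    (h : ∀ φ : Plane → ℝ, ContDiff ℝ ∞ φ → HasCompactSupport φ → tsupport φ ⊆ Ω →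
      ∫ x in Ω, fderiv ℝ φ x (EuclideanSpace.single 1 1) • W x =
        I • ∫ x in Ω, fderiv ℝ φ x (EuclideanSpace.single 0 1) • W x) :
    IsWeaklyHolomorphicOn (W ∘ complexToPlane) (complexToPlane ⁻¹' Ω) := by
  intro ψ hψ hc hs
  let φ : Plane → ℝ := ψ ∘ complexToPlane.symm
  have hsupp : tsupport φ ⊆ Ω := by
    rw [show tsupport φ = complexToPlane.symm ⁻¹' tsupport ψ from
      tsupport_comp_eq_preimage ψ complexToPlane.symm.toHomeomorph]
    exact fun x hx ↦ by simpa using hs hx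
  have hfd : ∀ z w, fderiv ℝ φ (complexToPlane z) (complexToPlane w) = fderiv ℝ ψ z w := by
    intro z w
    have hcomp := complexToPlane.symm.toContinuousLinearEquiv.comp_right_fderiv (f := ψ)
      (x := complexToPlane z)
    refine congr($hcomp (complexToPlane w)).trans ?_
    simp
  have hint : ∀ w, ∫ z, fderiv ℝ ψ z w • W (complexToPlane z) =
      ∫ x in Ω, fderiv ℝ φ x (complexToPlane w) • W x := by
    intro w
    rw [setIntegral_eq_integral_of_forall_compl_eq_zero fun x hx ↦ by
        rw [fderiv_of_notMem_tsupport ℝ fun hx' ↦ hx (hsupp hx'), zero_apply, zero_smul],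
      ← complexToPlane.measurePreserving.integral_comp
        complexToPlane.toHomeomorph.measurableEmbedding]
    simp only [hfd]
  have h1 : complexToPlane 1 = EuclideanSpace.single 0 1 := by ext i; fin_cases i <;> simp
  have hI : complexToPlane I = EuclideanSpace.single 1 1 := by ext i; fin_cases i <;> simp
  simp only [Function.comp_apply, hint, h1, hI]
  exact h φ (hψ.comp complexToPlane.symm.contDiff)
    (hc.comp_homeomorph complexToPlane.symm.toHomeomorph) hsupp

theorem IsWeaklyHolomorphicOn.exists_differentiableOn_comp_symm [CompleteSpace V] {p : ENNReal}
    (hΩ : IsOpen Ω) (hp : 1 ≤ p) (hW : MemLp W p (volume.restrict Ω))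
    (hw : IsWeaklyHolomorphicOn (W ∘ complexToPlane) (complexToPlane ⁻¹' Ω)) :
    ∃ G : ℂ → V, DifferentiableOn ℂ G (complexToPlane ⁻¹' Ω) ∧
      ∀ᵐ x ∂volume.restrict Ω, G (complexToPlane.symm x) = W x := by
  have hU : IsOpen (complexToPlane ⁻¹' Ω) := hΩ.preimage complexToPlane.continuous
  have hWe : MemLp (W ∘ complexToPlane) p (volume.restrict (complexToPlane ⁻¹' Ω)) :=
    hW.comp_measurePreserving (complexToPlane.measurePreserving.restrict_preimage_emb
      complexToPlane.toHomeomorph.measurableEmbedding Ω)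
  obtain ⟨G, hG, hGW⟩ := hw.exists_differentiableOn hU (locallyIntegrableOn_of_memLp hp hWe)
  refine ⟨G, hG, ?_⟩
  rw [Filter.EventuallyEq, ae_restrict_iff' hU.measurableSet] at hGW
  rw [ae_restrict_iff' hΩ.measurableSet]
  filter_upwards [complexToPlane.symm.measurePreserving.quasiMeasurePreserving.ae hGW]
    with x hx hxΩ
  simpa using hx (by simpa using hxΩ)

end ComplexPlane

section WeakConjugatePair

open Complex

/-- The weak Cauchy–Riemann equations `∇u + s Q∇v = 0` almost everywhere in `Ω`, for the weak
gradients; the classical ones correspond to `s = 1`, those of `(u, -v)` to `s = -1`. -/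
def IsWeakConjugatePair (Ω : Set Plane) (s : ℝ) (u v : Plane → ℝ) : Prop :=
  ∀ᵐ x ∂volume.restrict Ω, weakGrad Ω u x + s • rotQ (weakGrad Ω v x) = 0

variable {Ω : Set Plane} {u v : Plane → ℝ} {g h : Plane → Plane} {s : ℝ}

theorem IsWeakGradient.setIntegral_fderiv_smul (hu : LocallyIntegrableOn u Ω)
    (hv : LocallyIntegrableOn v Ω) (hg : LocallyIntegrableOn g Ω) (hh : LocallyIntegrableOn h Ω)
    (hug : IsWeakGradient Ω u g) (hvh : IsWeakGradient Ω v h) (κ : ℂ) {φ : Plane → ℝ}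
    (hφ : ContDiff ℝ ∞ φ) (hc : HasCompactSupport φ) (hs : tsupport φ ⊆ Ω) (i : Fin 2) :
    ∫ x in Ω, fderiv ℝ φ x (EuclideanSpace.single i 1) • ((u x : ℂ) + κ * v x) =
      -∫ x in Ω, φ x • ((g x i : ℂ) + κ * h x i) := by
  have hsplit : ∀ {ψ a b : Plane → ℝ}, Continuous ψ → HasCompactSupport ψ → tsupport ψ ⊆ Ω →
      LocallyIntegrableOn a Ω → LocallyIntegrableOn b Ω →
      ∫ x in Ω, ψ x • ((a x : ℂ) + κ * b x) =
        (∫ x in Ω, a x * ψ x : ℝ) + κ * (∫ x in Ω, b x * ψ x : ℝ) := by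
    intro ψ a b hψ hc hs ha hb
    have hint : ∀ {f : Plane → ℝ}, LocallyIntegrableOn f Ω →
        Integrable (fun x ↦ ((f x * ψ x : ℝ) : ℂ)) (volume.restrict Ω) := fun {f} hf ↦ by
      have hfψ : IntegrableOn (fun x ↦ ψ x * f x) Ω :=
        (integrable_smul_of_tsupport_subset hf hψ hc hs).integrableOn
      simp only [mul_comm (f _)]
      exact hfψ.ofReal
    rw [← integral_complex_ofReal, ← integral_complex_ofReal, ← integral_const_mul,
      ← integral_add (hint ha) ((hint hb).const_mul κ)]
    refine integral_congr_ae (.of_forall fun x ↦ ?_)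
    simp only [real_smul, ofReal_mul]
    ring
  have hcoord : ∀ {f : Plane → Plane}, LocallyIntegrableOn f Ω →
      LocallyIntegrableOn (fun x ↦ f x i) Ω := fun hf x hx ↦
    (hf x hx).imp fun t ht ↦ ⟨ht.1, (EuclideanSpace.proj (𝕜 := ℝ) i).integrable_comp ht.2⟩
  rw [hsplit ((hφ.continuous_fderiv (by simp)).clm_apply continuous_const)
      (hc.fderiv_apply (𝕜 := ℝ) _) ((tsupport_fderiv_apply_subset ℝ _).trans hs) hu hv,
    hsplit hφ.continuous hc hs (hcoord hg) (hcoord hh), hug φ hφ hc hs i, hvh φ hφ hc hs i]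
  push_cast
  ring

theorem IsWeakConjugatePair.isWeaklyHolomorphicOn (hu : MemH1 Ω u) (hv : MemH1 Ω v)
    (h : IsWeakConjugatePair Ω s u v) :
    IsWeaklyHolomorphicOn ((fun x ↦ (u x : ℂ) + s * I * v x) ∘ complexToPlane)
      (complexToPlane ⁻¹' Ω) := by
  refine isWeaklyHolomorphicOn_comp_complexToPlane fun φ hφ hc hs ↦ ?_
  have hdiv := IsWeakGradient.setIntegral_fderiv_smul (locallyIntegrableOn_of_memLp one_le_two hu.1)
    (locallyIntegrableOn_of_memLp one_le_two hv.1)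
    (locallyIntegrableOn_of_memLp one_le_two (weakGrad_spec hu).1)
    (locallyIntegrableOn_of_memLp one_le_two (weakGrad_spec hv).1)
    (weakGrad_spec hu).2 (weakGrad_spec hv).2 (s * I) hφ hc hs
  rw [hdiv, hdiv, smul_neg, ← integral_smul]
  refine congrArg _ (integral_congr_ae ?_)
  filter_upwards [h] with x hx
  have h0 : weakGrad Ω u x 0 = s * weakGrad Ω v x 1 := by
    simpa [← sub_eq_add_neg, sub_eq_zero] using congr($hx 0)
  have h1 : weakGrad Ω u x 1 = -(s * weakGrad Ω v x 0) := by
    simpa [add_eq_zero_iff_eq_neg] using congr($hx 1)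
  rw [h0, h1, smul_comm I]
  refine congrArg _ ?_
  push_cast
  rw [smul_eq_mul]
  linear_combination (-s * weakGrad Ω v x 0) * I_sq

theorem IsWeakConjugatePair.exists_differentiableOn (hΩ : IsOpen Ω) (hu : MemH1 Ω u)
    (hv : MemH1 Ω v) (h : IsWeakConjugatePair Ω s u v) :
    ∃ G : ℂ → ℂ, DifferentiableOn ℂ G (complexToPlane ⁻¹' Ω) ∧
      ∀ᵐ x ∂volume.restrict Ω, G (complexToPlane.symm x) = (u x : ℂ) + s * I * v x := by
  have hcast : ∀ {f : Plane → ℝ}, MemLp f 2 (volume.restrict Ω) →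
      MemLp (fun x ↦ (f x : ℂ)) 2 (volume.restrict Ω) := fun hf ↦ hf.ofReal
  have hW : MemLp (fun x ↦ (u x : ℂ) + s * I * v x) 2 (volume.restrict Ω) :=
    (hcast hu.1).add ((hcast hv.1).const_mul (s * I))
  exact (h.isWeaklyHolomorphicOn hu hv).exists_differentiableOn_comp_symm hΩ one_le_two hW

theorem IsWeakConjugatePair.exists_harmonicOnNhd (hΩ : IsOpen Ω) (hs : s ^ 2 = 1)
    (hu : MemH1 Ω u) (hv : MemH1 Ω v) (h : IsWeakConjugatePair Ω s u v) :
    ∃ u' v' : Plane → ℝ, u' =ᵐ[volume.restrict Ω] u ∧ v' =ᵐ[volume.restrict Ω] v ∧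
      HarmonicOnNhd u' Ω ∧ HarmonicOnNhd v' Ω ∧ ∀ x ∈ Ω, ∇ u' x + s • rotQ (∇ v' x) = 0 := by
  obtain ⟨G, hG, hGuv⟩ := h.exists_differentiableOn hΩ hu hv
  obtain ⟨hre, him⟩ := harmonicOnNhd_re_and_im_comp_complexToPlane_symm hΩ hG
  refine ⟨fun x ↦ (G (complexToPlane.symm x)).re, fun x ↦ s * (G (complexToPlane.symm x)).im,
    ?_, ?_, hre, fun x hx ↦ (him x hx).const_smul (c := s), fun x hx ↦ ?_⟩
  · filter_upwards [hGuv] with x hx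
    simp [hx]
  · filter_upwards [hGuv] with x hx
    rw [hx]
    simp only [add_im, ofReal_im, mul_im, mul_re, ofReal_re, I_re, I_im]
    linear_combination v x * hs
  · exact gradient_re_add_smul_rotQ_gradient_im hs (hG.differentiableAt
      ((hΩ.preimage complexToPlane.continuous).mem_nhds (by simpa using hx)))

theorem IsWeakConjugatePair.satisfiesOptimality (hs : s ^ 2 = 1)
    (h : IsWeakConjugatePair Ω s u v) : SatisfiesOptimality Ω s u v := by
  refine fun U _ ↦ ⟨integral_eq_zero_of_ae ?_, integral_eq_zero_of_ae ?_⟩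
  · filter_upwards [h] with x hx
    rw [hx, inner_zero_left, Pi.zero_apply]
  · filter_upwards [h] with x hx
    rw [sub_smul_rotQ_eq_neg hs, hx]
    simp [rotQ]

end WeakConjugatePair

section Energy

variable {Ω : Set Plane} {u v u' v' : Plane → ℝ} {s c : ℝ}

theorem integrable_detPair {μ : Measure Plane} {g h : Plane → Plane} (hg : MemLp g 2 μ)
    (hh : MemLp h 2 μ) : Integrable (fun x ↦ detPair (g x) (h x)) μ := by
  have hcoord : ∀ {f : Plane → Plane}, MemLp f 2 μ → ∀ i, MemLp (fun x ↦ f x i) 2 μ :=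
    fun hf i ↦ (EuclideanSpace.proj (𝕜 := ℝ) i : Plane →L[ℝ] ℝ).comp_memLp' hf
  simp only [detPair_eq]
  exact ((hcoord hg 0).integrable_mul (hcoord hh 1)).sub
    ((hcoord hg 1).integrable_mul (hcoord hh 0))

theorem integrable_norm_sq_add_norm_sq {X E : Type*} [MeasurableSpace X] {μ : Measure X}
    [NormedAddCommGroup E] {g h : X → E} (hg : MemLp g 2 μ) (hh : MemLp h 2 μ) :
    Integrable (fun x ↦ ‖g x‖ ^ 2 + ‖h x‖ ^ 2) μ :=
  (hg.integrable_norm_pow two_ne_zero).add (hh.integrable_norm_pow two_ne_zero)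

theorem integrable_norm_add_smul_rotQ_sq {μ : Measure Plane} {g h : Plane → Plane}
    (hs : s ^ 2 = 1) (hg : MemLp g 2 μ) (hh : MemLp h 2 μ) :
    Integrable (fun x ↦ ‖g x + s • rotQ (h x)‖ ^ 2) μ := by
  simp only [norm_add_smul_rotQ_sq, hs, one_mul]
  exact (integrable_norm_sq_add_norm_sq hg hh).sub ((integrable_detPair hg hh).const_mul _)

theorem IsAdmissible.dirichletEnergy_eq (hs : s ^ 2 = 1) (h : IsAdmissible Ω c u v) :
    dirichletEnergy Ω u v =
      s * c + (1 / 2) * ∫ x in Ω, ‖weakGrad Ω u x + s • rotQ (weakGrad Ω v x)‖ ^ 2 := by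
  obtain ⟨hu, hv, rfl⟩ := h
  have hgu := (weakGrad_spec hu).1
  have hgv := (weakGrad_spec hv).1
  simp only [norm_add_smul_rotQ_sq, hs, one_mul, dirichletEnergy]
  rw [integral_sub (integrable_norm_sq_add_norm_sq hgu hgv)
    ((integrable_detPair hgu hgv).const_mul _), integral_const_mul]
  ring

theorem IsAdmissible.mul_le_dirichletEnergy (hs : s ^ 2 = 1) (h : IsAdmissible Ω c u v) :
    s * c ≤ dirichletEnergy Ω u v := by
  rw [h.dirichletEnergy_eq hs]
  exact le_add_of_nonneg_right (by positivity)

theorem IsAdmissible.dirichletEnergy_eq_mul_iff (hs : s ^ 2 = 1) (h : IsAdmissible Ω c u v) :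
    dirichletEnergy Ω u v = s * c ↔ IsWeakConjugatePair Ω s u v := by
  rw [h.dirichletEnergy_eq hs, add_eq_left, mul_eq_zero_iff_left (by norm_num),
    integral_eq_zero_iff_of_nonneg (fun x ↦ sq_nonneg _)
      (integrable_norm_add_smul_rotQ_sq hs (weakGrad_spec h.1).1 (weakGrad_spec h.2.1).1)]
  exact Filter.eventually_congr (.of_forall fun x ↦ by simp)

theorem IsAdmissible.congr_ae (hΩ : IsOpen Ω) (h : IsAdmissible Ω c u v)
    (hu : u' =ᵐ[volume.restrict Ω] u) (hv : v' =ᵐ[volume.restrict Ω] v) :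
    IsAdmissible Ω c u' v' := by
  refine ⟨h.1.congr_ae hu, h.2.1.congr_ae hv, h.2.2 ▸ integral_congr_ae ?_⟩
  filter_upwards [weakGrad_congr_ae hΩ h.1 hu, weakGrad_congr_ae hΩ h.2.1 hv] with x hux hvx
  rw [hux, hvx]

theorem IsConstrainedMinimizer.congr_ae (hΩ : IsOpen Ω) (h : IsConstrainedMinimizer Ω c u v)
    (hu : u' =ᵐ[volume.restrict Ω] u) (hv : v' =ᵐ[volume.restrict Ω] v) :
    IsConstrainedMinimizer Ω c u' v' := by
  refine ⟨h.1.congr_ae hΩ hu hv, fun u₁ v₁ h₁ ↦ (le_of_eq ?_).trans (h.2 u₁ v₁ h₁)⟩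
  refine congrArg _ (integral_congr_ae ?_)
  filter_upwards [weakGrad_congr_ae hΩ h.1.1 hu, weakGrad_congr_ae hΩ h.1.2.1 hv] with x hux hvx
  rw [hux, hvx]

theorem IsAdmissible.not_forall_eq (hΩ : IsOpen Ω) (hc : c ≠ 0) (h : IsAdmissible Ω c u v) :
    (¬ ∃ a : ℝ, ∀ x ∈ Ω, u x = a) ∧ ¬ ∃ a : ℝ, ∀ x ∈ Ω, v x = a := by
  have hzero : ∀ {w : Plane → ℝ}, MemH1 Ω w → (∃ a : ℝ, ∀ x ∈ Ω, w x = a) →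
      weakGrad Ω w =ᵐ[volume.restrict Ω] 0 := fun hw ⟨a, ha⟩ ↦
    weakGrad_ae_eq_zero hΩ hw (ae_restrict_of_forall_mem hΩ.measurableSet ha)
  constructor <;> refine fun hconst ↦ hc (h.2.2 ▸ integral_eq_zero_of_ae ?_)
  · filter_upwards [hzero h.1 hconst] with x hx
    simp [detPair_eq, hx]
  · filter_upwards [hzero h.2.1 hconst] with x hx
    simp [detPair_eq, hx]

theorem isAdmissible_inner_and_isWeakConjugatePair (hΩ : IsOpen Ω)
    (hid : MemLp id 2 (volume.restrict Ω)) (hs : s ^ 2 = 1) (p : Plane) :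
    IsAdmissible Ω (s * ‖p‖ ^ 2 * volume.real Ω) (fun x ↦ inner ℝ p x)
        (fun x ↦ inner ℝ (s • rotQ p) x) ∧
      IsWeakConjugatePair Ω s (fun x ↦ inner ℝ p x) (fun x ↦ inner ℝ (s • rotQ p) x) := by
  obtain ⟨hu, hgu⟩ := memH1_inner_and_weakGrad_inner hΩ hid p
  obtain ⟨hv, hgv⟩ := memH1_inner_and_weakGrad_inner hΩ hid (s • rotQ p)
  refine ⟨⟨hu, hv, ?_⟩, ?_⟩
  · rw [integral_congr_ae (g := fun _ ↦ s * ‖p‖ ^ 2), setIntegral_const, smul_eq_mul, mul_comm]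
    filter_upwards [hgu, hgv] with x hux hvx
    rw [hux, hvx, detPair_smul_rotQ]
  · filter_upwards [hgu, hgv] with x hux hvx
    rw [hux, hvx, add_smul_rotQ_smul_rotQ hs]

theorem exists_isAdmissible_isWeakConjugatePair (hΩ : IsOpen Ω) (hne : Ω.Nonempty)
    (hid : MemLp id 2 (volume.restrict Ω)) (hs : s ^ 2 = 1) (hsc : 0 ≤ s * c) :
    ∃ u v, IsAdmissible Ω c u v ∧ IsWeakConjugatePair Ω s u v := by
  have hfin := isFiniteMeasure_restrict.1 (isFiniteMeasure_of_memLp_id two_ne_zero (by simp) hid)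
  have hvol : 0 < volume.real Ω := ENNReal.toReal_pos (hΩ.measure_pos volume hne).ne' hfin
  obtain ⟨p, hp⟩ := exists_norm_eq Plane (Real.sqrt_nonneg (s * c / volume.real Ω))
  have hpc : s * ‖p‖ ^ 2 * volume.real Ω = c := by
    rw [hp, Real.sq_sqrt (by positivity)]
    field_simp
    linear_combination c * hs
  exact ⟨_, _, hpc ▸ isAdmissible_inner_and_isWeakConjugatePair hΩ hid hs p⟩

theorem isConstrainedMinimizer_iff (hΩ : IsOpen Ω) (hne : Ω.Nonempty)
    (hid : MemLp id 2 (volume.restrict Ω)) (hs : s ^ 2 = 1) (hsc : 0 ≤ s * c) :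
    IsConstrainedMinimizer Ω c u v ↔ IsAdmissible Ω c u v ∧ IsWeakConjugatePair Ω s u v := by
  refine and_congr_right fun h ↦ ?_
  rw [← h.dirichletEnergy_eq_mul_iff hs]
  refine ⟨fun hmin ↦ ?_, fun heq u' v' h' ↦ heq.trans_le (h'.mul_le_dirichletEnergy hs)⟩
  obtain ⟨u₀, v₀, h₀, hconj⟩ := exists_isAdmissible_isWeakConjugatePair hΩ hne hid hs hsc
  exact le_antisymm ((hmin u₀ v₀ h₀).trans_eq ((h₀.dirichletEnergy_eq_mul_iff hs).2 hconj))
    (h.mul_le_dirichletEnergy hs)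

theorem exists_isNontrivialConjugatePair (hΩ : IsOpen Ω) (hs : s ^ 2 = 1) (hc : c ≠ 0)
    (h : IsAdmissible Ω c u v) (hconj : IsWeakConjugatePair Ω s u v) :
    ∃ u' v' : Plane → ℝ, u' =ᵐ[volume.restrict Ω] u ∧ v' =ᵐ[volume.restrict Ω] v ∧
      IsNontrivialConjugatePair Ω s u' v' := by
  obtain ⟨u', v', hu, hv, hu', hv', hgrad⟩ := hconj.exists_harmonicOnNhd hΩ hs h.1 h.2.1
  obtain ⟨hnu, hnv⟩ := (h.congr_ae hΩ hu hv).not_forall_eq hΩ hc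
  exact ⟨u', v', hu, hv, hu', hv', hnu, hnv, hgrad⟩

end Energy

theorem mainTheorem7_general (Ω : Set Plane) (hopen : IsOpen Ω) (hne : Ω.Nonempty)
    (hid : MemLp id 2 (volume.restrict Ω)) :
    (∀ c : ℝ, 0 < c → ∃ u v : Plane → ℝ,
      IsConstrainedMinimizer Ω c u v ∧ IsNontrivialConjugatePair Ω 1 u v) ∧
    (∀ c : ℝ, c ≠ 0 →
      (∃ u v : Plane → ℝ, IsConstrainedMinimizer Ω c u v) ∧
      ∀ u v : Plane → ℝ, IsConstrainedMinimizer Ω c u v →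
        SatisfiesOptimality Ω (Real.sign c) u v ∧
        ∃ u' v' : Plane → ℝ,
          u' =ᵐ[volume.restrict Ω] u ∧ v' =ᵐ[volume.restrict Ω] v ∧
          IsNontrivialConjugatePair Ω (Real.sign c) u' v') := by
  have hs : ∀ {c : ℝ}, c ≠ 0 → Real.sign c ^ 2 = 1 := fun {c} hc ↦ by
    rcases Real.sign_apply_eq_of_ne_zero c hc with h | h <;> simp [h]
  have hiff {c : ℝ} (hc : c ≠ 0) (u v : Plane → ℝ) :=
    isConstrainedMinimizer_iff (u := u) (v := v) hopen hne hid (hs hc) (Real.sign_mul_nonneg c)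
  have hexists {c : ℝ} (hc : c ≠ 0) : ∃ u v, IsConstrainedMinimizer Ω c u v := by
    simpa only [hiff hc] using
      exists_isAdmissible_isWeakConjugatePair hopen hne hid (hs hc) (Real.sign_mul_nonneg c)
  refine ⟨fun c hc ↦ ?_, fun c hc ↦ ⟨hexists hc, fun u v hmin ↦ ?_⟩⟩
  · obtain ⟨u, v, hmin⟩ := hexists hc.ne'
    obtain ⟨hadm, hconj⟩ := (hiff hc.ne' u v).1 hmin
    obtain ⟨u', v', hu, hv, hpair⟩ :=
      exists_isNontrivialConjugatePair hopen (hs hc.ne') hc.ne' hadm hconj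
    exact ⟨u', v', hmin.congr_ae hopen hu hv, Real.sign_of_pos hc ▸ hpair⟩
  · obtain ⟨hadm, hconj⟩ := (hiff hc u v).1 hmin
    exact ⟨hconj.satisfiesOptimality (hs hc),
      exists_isNontrivialConjugatePair hopen (hs hc) hc hadm hconj⟩

theorem mainTheorem7 (Ω : Set Plane) (hopen : IsOpen Ω) (hconn : IsConnected Ω)
    (hbdd : Bornology.IsBounded Ω) :
    -- non-trivial Cauchy-Riemann pairs of harmonic functions, as constrained minimisers
    (∀ c : ℝ, 0 < c → ∃ u v : Plane → ℝ,
      IsConstrainedMinimizer Ω c u v ∧ IsNontrivialConjugatePair Ω 1 u v) ∧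
    -- minimisers exist for each non-zero constant, and every minimiser is such a pair
    -- (up to null sets, and with the sign of the constant)
    (∀ c : ℝ, c ≠ 0 →
      (∃ u v : Plane → ℝ, IsConstrainedMinimizer Ω c u v) ∧
      ∀ u v : Plane → ℝ, IsConstrainedMinimizer Ω c u v →
        SatisfiesOptimality Ω (Real.sign c) u v ∧
        ∃ u' v' : Plane → ℝ,
          u' =ᵐ[volume.restrict Ω] u ∧ v' =ᵐ[volume.restrict Ω] v ∧
          IsNontrivialConjugatePair Ω (Real.sign c) u' v') :=
  mainTheorem7_general Ω hopen hconn.nonempty (memLp_id_of_isBounded hbdd 2)
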